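/- Let $\Omega\subset\mathbb R^2$ be a bounded open set that is star-shaped with respect to one of its points. Let $Ay=-\sum_{i,j}\partial_i(a_{ij}\partial_j y)+c_0y$ with $a_{ij}=a_{ji}\in C(\bar\Omega)$ uniformly elliptic on $\Omega$ and $0\le c_0\in L^\infty(\Omega)$, let $f\in L^2(\Omega)$, $y_d\in L^p(\Omega)$ with $p>2$, $\alpha,\beta>0$, $q\in(0,1)$ and $u_a<0<u_b$. For $w\in L^2(\Omega)$ let $Sw\in H_0^1(\Omega)$ be the weak solution of $Ay=w$ in $\Omega$, $y=0$ on $\partial\Omega$. Put $U_{ad}=\{u\in L^2(\Omega): u_a\le u\le u_b \text{ a.e. in }\Omega\}$ and, for $\gamma>0$, $$J_\gamma(u)=\tfrac12\|S(u+f)-y_d\|_{L^2(\Omega)}^2+\tfrac\alpha2\|u\|_{L^2(\Omega)}^2+\beta\int_\Omega h_{q,\gamma}(u(x))^q\,dx ,$$ where $h_{q,\gamma}(t)=q\gamma^{(1-q)/q}|t|^{1/q}$ if $|t|\le 1/\gamma$ and $h_{q,\gamma}(t)=|t|-\frac{1-q}{\gamma}$ otherwise. Let $\delta_\gamma=q^q\gamma^{1-q}$,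 let $j_\gamma(t)=\big[\delta_\gamma-q\big(|t|+\frac{q-1}{\gamma}\big)^{q-1}\big]\,\mathrm{sign}(t)$ if $|t|>1/\gamma$ and $j_\gamma(t)=0$ otherwise, and let $s^*=\big(\frac\beta\alpha q(1-q)\big)^{1/(2-q)}$. Then there is $\gamma_0>0$ such that the following holds for all $\gamma>\gamma_0$. Let $\bar u\in U_{ad}$ satisfy the KKT system: with $\bar y=S(\bar u+f)$, there are $\bar\phi\in H_0^1(\Omega)$ solving $A^*\bar\phi=\bar y-y_d$ weakly, $\bar\zeta\in L^\infty(\Omega)$ and $\lambda_a,\lambda_b\in L^2(\Omega)$ such that a.e. in $\Omega$ $$\bar\phi+\alpha\bar u+\beta\,(\delta_\gamma\bar\zeta-j_\gamma(\bar u))+\lambda_b-\lambda_a=0,\quad \lambda_a,\lambda_b\ge0,\quad \lambda_a(\bar u-u_a)=0,\quad \lambda_b(u_b-\bar u)=0,$$ and $\bar\zeta=1$ where $\bar u>0$, $\bar\zeta=-1$ where $\bar u<0$, $|\bar\zeta|\le1$ where $\bar u=0$. Assume moreover that there is a constant $C>1$ such that $|\bar u(x)|\ge C s^*+\frac{1-q}{\gamma}$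 for almost all $x\in\Omega$ with $\bar u(x)\ne0$. Then there exist $\varrho>0$ and $\sigma>0$ such that $$\sigma\,\|u-\bar u\|_{L^2(\Omega)}^2\le J_\gamma(u)-J_\gamma(\bar u)\qquad\text{for all } u\in U_{ad}\text{ with }\|u-\bar u\|_{L^\infty(\Omega)}\le\varrho .$$ -/

import Mathlib

open MeasureTheory Set
open scoped ENNReal ContDiff

noncomputable section

namespace DCControl

/-- The plane with its Euclidean norm. -/
abbrev Plane : Type := EuclideanSpace ℝ (Fin 2)

/-- The real Hilbert space `L²(Ω)`. -/
abbrev L2 (Ω : Set Plane) : Type := Lp ℝ 2 (volume.restrict Ω)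

/-- The Hilbert space `L²(Ω; ℝ²)` of square integrable vector fields. -/
abbrev L2Vec (Ω : Set Plane) : Type := Lp Plane 2 (volume.restrict Ω)

/-- Standing assumption on the domain: open, bounded and star-shaped with respect to one of its
points. -/
structure IsStarShapedDomain (Ω : Set Plane) : Prop where
  isOpen : IsOpen Ω
  isBounded : Bornology.IsBounded Ω
  starShaped : ∃ x₀ ∈ Ω, StarConvex ℝ x₀ Ω

/-! ### The Sobolev space `H₀¹(Ω)` -/

/-- The pairs `(φ, ∇φ)` in `L²(Ω) × L²(Ω; ℝ²)`, where `φ` runs over `C_c^∞(Ω)`. -/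
def testGraph (Ω : Set Plane) : Submodule ℝ (WithLp 2 (L2 Ω × L2Vec Ω)) where
  carrier := {p | ∃ φ : Plane → ℝ, ContDiff ℝ ∞ φ ∧ HasCompactSupport φ ∧ tsupport φ ⊆ Ω ∧
    p.fst =ᵐ[volume.restrict Ω] φ ∧ p.snd =ᵐ[volume.restrict Ω] gradient φ}
  add_mem' := by
    rintro p r ⟨φ, h1, h2, h3, h4, h5⟩ ⟨ψ, k1, k2, k3, k4, k5⟩
    refine ⟨φ + ψ, h1.add k1, h2.add k2, ?_, ?_, ?_⟩
    · exact (tsupport_add φ ψ).trans (union_subset h3 k3)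
    · rw [WithLp.add_fst]
      exact (Lp.coeFn_add _ _).trans (h4.add k4)
    · rw [WithLp.add_snd]
      refine (Lp.coeFn_add _ _).trans ((h5.add k5).trans (.of_forall fun x ↦ ?_))
      have e1 := (h1.differentiable (by simp)) x
      have e2 := (k1.differentiable (by simp)) x
      simp [gradient, fderiv_add e1 e2]
  zero_mem' := by
    refine ⟨0, contDiff_const, HasCompactSupport.zero, by simp, ?_, ?_⟩
    · rw [WithLp.zero_fst]
      exact Lp.coeFn_zero _ _ _
    · rw [WithLp.zero_snd]
      refine (Lp.coeFn_zero _ _ _).trans (.of_forall fun x ↦ ?_)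
      simp [gradient]
  smul_mem' := by
    rintro c p ⟨φ, h1, h2, h3, h4, h5⟩
    refine ⟨c • φ, contDiff_const.smul h1, h2.smul_left, ?_, ?_, ?_⟩
    · exact (tsupport_smul_subset_right (fun _ ↦ c) φ).trans h3
    · rw [WithLp.smul_fst]
      exact (Lp.coeFn_smul _ _).trans (h4.const_smul c)
    · rw [WithLp.smul_snd]
      refine (Lp.coeFn_smul _ _).trans ((h5.const_smul c).trans (.of_forall fun x ↦ ?_))
      have e1 := (h1.differentiable (by simp)) x
      simp [gradient, fderiv_const_smul e1]

/-- `H₀¹(Ω)`, the closure of `C_c^∞(Ω)` in the `H¹`-norm; an element is recorded together with its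
weak gradient. -/
def H01 (Ω : Set Plane) : Submodule ℝ (WithLp 2 (L2 Ω × L2Vec Ω)) :=
  (testGraph Ω).topologicalClosure

instance (Ω : Set Plane) : CompleteSpace (H01 Ω) :=
  inferInstanceAs (CompleteSpace (testGraph Ω).topologicalClosure)

/-- The embedding `H₀¹(Ω) → L²(Ω)`. -/
def toL2 {Ω : Set Plane} (y : H01 Ω) : L2 Ω := y.1.fst

/-- The weak gradient of an element of `H₀¹(Ω)`. -/
def grad {Ω : Set Plane} (y : H01 Ω) : L2Vec Ω := y.1.snd

/-! ### The elliptic operator and its solution operator -/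

/-- The data of a uniformly elliptic operator `A y = - ∑ ∂ᵢ (aᵢⱼ ∂ⱼ y) + c₀ y` on `Ω`. -/
structure EllipticOperator (Ω : Set Plane) where
  a : Fin 2 → Fin 2 → Plane → ℝ
  c₀ : Plane → ℝ
  a_continuousOn : ∀ i j, ContinuousOn (a i j) (closure Ω)
  a_symm : ∀ i j, ∀ x ∈ closure Ω, a i j x = a j i x
  elliptic : ∃ θ : ℝ, 0 < θ ∧ ∀ᵐ x ∂(volume.restrict Ω), ∀ ξ : Plane,
    θ * ‖ξ‖ ^ 2 ≤ ∑ i, ∑ j, a i j x * ξ i * ξ j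
  c₀_memLp : MemLp c₀ ∞ (volume.restrict Ω)
  c₀_nonneg : ∀ᵐ x ∂(volume.restrict Ω), 0 ≤ c₀ x

variable {Ω : Set Plane}

/-- The bilinear form `a(y, v) = ∫_Ω ∑ aᵢⱼ ∂ⱼy ∂ᵢv + c₀ y v` associated with the operator. -/
def EllipticOperator.form (A : EllipticOperator Ω) (y v : H01 Ω) : ℝ :=
  ∫ x in Ω, (∑ i, ∑ j, A.a i j x * grad y x j * grad v x i) + A.c₀ x * toL2 y x * toL2 v x

/-- `y` is the weak solution of `A y = w` in `Ω`, `y = 0` on the boundary. -/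
def EllipticOperator.IsWeakSolution (A : EllipticOperator Ω) (w : L2 Ω) (y : H01 Ω) : Prop :=
  ∀ v : H01 Ω, A.form y v = inner ℝ w (toL2 v)

/-- `φ` is the weak solution of the adjoint equation `A* φ = w` in `Ω`, `φ = 0` on the
boundary. -/
def EllipticOperator.IsAdjointSolution (A : EllipticOperator Ω) (w : L2 Ω) (φ : H01 Ω) : Prop :=
  ∀ v : H01 Ω, A.form v φ = inner ℝ w (toL2 v)

/-- Multiplication by an essentially bounded function, on `L²(Ω)`. -/
def mulL {b : Plane → ℝ} (hb : MemLp b ∞ (volume.restrict Ω)) : L2 Ω →L[ℝ] L2 Ω :=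
  LinearMap.mkContinuous
    { toFun := fun f ↦ hb.toLp b • f
      map_add' := fun f g ↦ Lp.add_smul _ f g
      map_smul' := fun c f ↦ (Lp.smul_comm c _ f).symm }
    ‖hb.toLp b‖ (Lp.norm_smul_le _)

theorem mulL_apply {b : Plane → ℝ} (hb : MemLp b ∞ (volume.restrict Ω)) (f : L2 Ω) :
    mulL hb f =ᵐ[volume.restrict Ω] fun x ↦ b x * f x := by
  have := Lp.coeFn_lpSMul (r := 2) (hb.toLp b) f
  filter_upwards [this, hb.coeFn_toLp] with x h1 h2
  change (hb.toLp b • f : L2 Ω) x = _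
  rw [h1]; simp [h2]

theorem integrable_triple {b : Plane → ℝ} (hb : MemLp b ∞ (volume.restrict Ω)) (f g : L2 Ω) :
    Integrable (fun x ↦ b x * f x * g x) (volume.restrict Ω) := by
  have := (Lp.memLp (mulL hb f)).integrable_mul (Lp.memLp g)
  refine this.congr ?_
  filter_upwards [mulL_apply hb f] with x hx
  simp [hx]

theorem integral_triple {b : Plane → ℝ} (hb : MemLp b ∞ (volume.restrict Ω)) (f g : L2 Ω) :
    ∫ x in Ω, b x * f x * g x = inner ℝ (mulL hb f) g := by
  rw [L2.inner_def]
  refine integral_congr_ae ?_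
  filter_upwards [mulL_apply hb f] with x hx
  simp [hx, mul_comm]

/-- Components of a vector field, as a continuous linear map `L²(Ω; ℝ²) → L²(Ω)`. -/
def compL (Ω : Set Plane) (i : Fin 2) : L2Vec Ω →L[ℝ] L2 Ω :=
  (EuclideanSpace.proj (𝕜 := ℝ) i : Plane →L[ℝ] ℝ).compLpL 2 (volume.restrict Ω)

theorem compL_apply (i : Fin 2) (g : L2Vec Ω) :
    compL Ω i g =ᵐ[volume.restrict Ω] fun x ↦ g x i :=
  (EuclideanSpace.proj (𝕜 := ℝ) i : Plane →L[ℝ] ℝ).coeFn_compLpL g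

/-- The embedding `H₀¹(Ω) → L²(Ω)` as a continuous linear map. -/
def toL2L (Ω : Set Plane) : H01 Ω →L[ℝ] L2 Ω :=
  (WithLp.fstL 2 ℝ (L2 Ω) (L2Vec Ω)).comp (H01 Ω).subtypeL

theorem toL2L_apply (y : H01 Ω) : toL2L Ω y = toL2 y := rfl

/-- The weak gradient as a continuous linear map. -/
def gradL (Ω : Set Plane) : H01 Ω →L[ℝ] L2Vec Ω :=
  (WithLp.sndL 2 ℝ (L2 Ω) (L2Vec Ω)).comp (H01 Ω).subtypeL

theorem gradL_apply (y : H01 Ω) : gradL Ω y = grad y := rfl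

theorem norm_sq_H01 (y : H01 Ω) : ‖y‖ ^ 2 = ‖toL2 y‖ ^ 2 + ‖grad y‖ ^ 2 :=
  WithLp.prod_norm_sq_eq_of_L2 y.1

theorem a_memLp (hΩ : IsStarShapedDomain Ω) (A : EllipticOperator Ω) (i j : Fin 2) :
    MemLp (A.a i j) ∞ (volume.restrict Ω) := by
  obtain ⟨C, hC⟩ := hΩ.isBounded.isCompact_closure.exists_bound_of_continuousOn
    (A.a_continuousOn i j)
  refine memLp_top_of_bound (((A.a_continuousOn i j).mono subset_closure).aestronglyMeasurable
    hΩ.isOpen.measurableSet) C ?_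
  filter_upwards [ae_restrict_mem hΩ.isOpen.measurableSet] with x hx
  exact hC x (subset_closure hx)

/-- The bilinear form as a continuous bilinear map. -/
def formL (hΩ : IsStarShapedDomain Ω) (A : EllipticOperator Ω) : H01 Ω →L[ℝ] H01 Ω →L[ℝ] ℝ :=
  (∑ i, ∑ j, ((innerSL ℝ).comp (mulL (a_memLp hΩ A i j))).bilinearComp
    ((compL Ω j).comp (gradL Ω)) ((compL Ω i).comp (gradL Ω))) +
  ((innerSL ℝ).comp (mulL A.c₀_memLp)).bilinearComp (toL2L Ω) (toL2L Ω)

theorem integrable_form (hΩ : IsStarShapedDomain Ω) (A : EllipticOperator Ω) (y v : H01 Ω)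
    (i j : Fin 2) : Integrable (fun x ↦ A.a i j x * grad y x j * grad v x i)
      (volume.restrict Ω) := by
  refine (integrable_triple (a_memLp hΩ A i j) (compL Ω j (grad y)) (compL Ω i (grad v))).congr ?_
  filter_upwards [compL_apply j (grad y), compL_apply i (grad v)] with x h1 h2
  rw [h1, h2]

theorem formL_apply (hΩ : IsStarShapedDomain Ω) (A : EllipticOperator Ω) (y v : H01 Ω) :
    formL hΩ A y v = A.form y v := by
  have e : ∀ i j, inner ℝ (mulL (a_memLp hΩ A i j) (compL Ω j (grad y))) (compL Ω i (grad v)) =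
      ∫ x in Ω, A.a i j x * grad y x j * grad v x i := fun i j ↦ by
    rw [← integral_triple]
    refine integral_congr_ae ?_
    filter_upwards [compL_apply j (grad y), compL_apply i (grad v)] with x h1 h2
    rw [h1, h2]
  have e' := (integral_triple A.c₀_memLp (toL2 y) (toL2 v)).symm
  rw [EllipticOperator.form, integral_add, integral_finsetSum]
  · simp_rw [integral_finsetSum _ fun j _ ↦ integrable_form hΩ A y v _ j, ← e]
    rw [← e']
    simp [formL, toL2L_apply, gradL_apply]
  · exact fun i _ ↦ integrable_finsetSum _ fun j _ ↦ integrable_form hΩ A y v i j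
  · exact integrable_finsetSum _ fun i _ ↦ integrable_finsetSum _ fun j _ ↦
      integrable_form hΩ A y v i j
  · exact integrable_triple A.c₀_memLp _ _

/-- The Poincaré inequality. -/
theorem poincare (hΩ : IsStarShapedDomain Ω) :
    ∃ C : ℝ, 0 ≤ C ∧ ∀ y : H01 Ω, ‖toL2 y‖ ≤ C * ‖grad y‖ := by
  have hfin : volume Ω < ⊤ := hΩ.isBounded.measure_lt_top
  set K : ℝ≥0∞ := eLpNormLESNormFDerivOfLeConst ℝ (volume : Measure Plane) Ω 1 2 *
    (volume Ω) ^ (1 / (1 : ℝ≥0∞).toReal - 1 / (2 : ℝ≥0∞).toReal) with hK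
  have hKt : K ≠ ⊤ := by
    refine ENNReal.mul_ne_top (by simp) (ENNReal.rpow_ne_top_of_nonneg (by norm_num) hfin.ne)
  refine ⟨K.toReal, ENNReal.toReal_nonneg, fun y ↦ ?_⟩
  have hcl : IsClosed {p : WithLp 2 (L2 Ω × L2Vec Ω) | ‖p.fst‖ ≤ K.toReal * ‖p.snd‖} :=
    isClosed_le (WithLp.fstL 2 ℝ (L2 Ω) (L2Vec Ω)).continuous.norm
      ((WithLp.sndL 2 ℝ (L2 Ω) (L2Vec Ω)).continuous.norm.const_mul _)
  refine closure_minimal ?_ hcl y.2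
  rintro p ⟨φ, h1, h2, h3, h4, h5⟩
  have hsupp : φ.support ⊆ Ω := (subset_tsupport φ).trans h3
  have hsupp' : (fderiv ℝ φ).support ⊆ Ω := (support_fderiv_subset ℝ).trans h3
  have key : eLpNorm φ 2 (volume.restrict Ω) ≤ K * eLpNorm (gradient φ) 2 (volume.restrict Ω) := by
    have s1 := eLpNorm_le_eLpNorm_fderiv_of_le (volume : Measure Plane) (F := ℝ) (p := 1) (q := 2)
      (h1.of_le (by simp)) hsupp le_rfl (by simp) (by simp; norm_num) hΩ.isBounded
    have s2 := eLpNorm_le_eLpNorm_mul_rpow_measure_univ (μ := volume.restrict Ω) (p := 1) (q := 2)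
      (f := fderiv ℝ φ) (by norm_num)
      (h1.continuous_fderiv (by simp)).aestronglyMeasurable
    have s0 : eLpNorm (fderiv ℝ φ) 1 (volume.restrict Ω) = eLpNorm (fderiv ℝ φ) 1 volume :=
      eLpNorm_restrict_eq_of_support_subset (ε := Plane →L[ℝ] ℝ) (by exact hsupp')
    rw [s0] at s2
    have s3 : eLpNorm (gradient φ) 2 (volume.restrict Ω) =
        eLpNorm (fderiv ℝ φ) 2 (volume.restrict Ω) :=
      eLpNorm_congr_norm_ae (.of_forall fun x ↦ by simp [gradient])
    rw [eLpNorm_restrict_eq_of_support_subset hsupp, s3]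
    rw [Measure.restrict_apply_univ] at s2
    refine (le_trans (by simpa using s1) (mul_le_mul_right s2 _)).trans_eq ?_
    rw [hK]; ring
  change ‖p.fst‖ ≤ K.toReal * ‖p.snd‖
  rw [Lp.norm_def, Lp.norm_def, ← ENNReal.toReal_mul]
  refine ENNReal.toReal_mono (ENNReal.mul_ne_top hKt (Lp.eLpNorm_ne_top _)) ?_
  rwa [eLpNorm_congr_ae h4, eLpNorm_congr_ae h5]

theorem formL_coercive (hΩ : IsStarShapedDomain Ω) (A : EllipticOperator Ω) :
    IsCoercive (formL hΩ A) := by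
  obtain ⟨θ, hθ, hell⟩ := A.elliptic
  obtain ⟨C, hC, hP⟩ := poincare hΩ
  refine ⟨θ / (C ^ 2 + 1), by positivity, fun y ↦ ?_⟩
  have h1 : θ * ‖grad y‖ ^ 2 ≤ formL hΩ A y y := by
    rw [formL_apply, ← real_inner_self_eq_norm_sq, L2.inner_def, ← integral_const_mul]
    refine integral_mono_ae ((L2.integrable_inner _ _).const_mul _) ?_ ?_
    · exact (integrable_finsetSum _ fun i _ ↦ integrable_finsetSum _ fun j _ ↦
        integrable_form hΩ A y y i j).add (integrable_triple A.c₀_memLp _ _)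
    · filter_upwards [hell, A.c₀_nonneg] with x h2 h3
      have h4 : 0 ≤ A.c₀ x * toL2 y x * toL2 y x := by
        rw [mul_assoc]; exact mul_nonneg h3 (mul_self_nonneg _)
      have h5 := h2 (grad y x)
      have h6 : ∑ i, ∑ j, A.a i j x * grad y x i * grad y x j =
          ∑ i, ∑ j, A.a i j x * grad y x j * grad y x i :=
        Finset.sum_congr rfl fun i _ ↦ Finset.sum_congr rfl fun j _ ↦ by ring
      rw [h6] at h5
      simp only [real_inner_self_eq_norm_sq]
      linarith
  have h2 : ‖y‖ ^ 2 ≤ (C ^ 2 + 1) * ‖grad y‖ ^ 2 := by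
    have := pow_le_pow_left₀ (norm_nonneg _) (hP y) 2
    rw [norm_sq_H01]; nlinarith
  rw [mul_assoc, ← sq, div_mul_eq_mul_div, div_le_iff₀ (by positivity)]
  nlinarith

/-- The solution operator `S : L²(Ω) → H₀¹(Ω)` of the equation `A y = w`, `y = 0` on the boundary,
from the Lax-Milgram theorem. -/
def solOp (hΩ : IsStarShapedDomain Ω) (A : EllipticOperator Ω) : L2 Ω →L[ℝ] H01 Ω :=
  ((formL_coercive hΩ A).continuousLinearEquivOfBilin.symm : H01 Ω →L[ℝ] H01 Ω).comp
    (ContinuousLinearMap.adjoint (toL2L Ω))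

/-- `S w` is the unique weak solution of the equation with right-hand side `w`. -/
theorem isWeakSolution_iff (hΩ : IsStarShapedDomain Ω) (A : EllipticOperator Ω) (w : L2 Ω)
    (y : H01 Ω) : A.IsWeakSolution w y ↔ y = solOp hΩ A w := by
  have h : A.IsWeakSolution w y ↔ (formL_coercive hΩ A).continuousLinearEquivOfBilin y =
      ContinuousLinearMap.adjoint (toL2L Ω) w := by
    rw [ext_iff_inner_right ℝ]
    refine forall_congr' fun v ↦ ?_
    rw [IsCoercive.continuousLinearEquivOfBilin_apply, formL_apply,
      ContinuousLinearMap.adjoint_inner_left, toL2L_apply]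
  rw [h, solOp]
  exact ((formL_coercive hΩ A).continuousLinearEquivOfBilin.eq_symm_apply).symm

/-! ### The optimal control problem -/

/-- The data of the regularized sparse control problem, with the standing assumptions on them. -/
structure ControlProblem (Ω : Set Plane) where
  domain : IsStarShapedDomain Ω
  A : EllipticOperator Ω
  /-- The fixed source term of the state equation. -/
  f : L2 Ω
  /-- The desired state, which lies in `L^p(Ω)` for some `p > 2`. -/
  yd : Plane → ℝ
  p : ℝ≥0∞
  two_lt_p : 2 < p
  yd_memLp : MemLp yd p (volume.restrict Ω)
  α : ℝ
  β : ℝ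
  q : ℝ
  ua : ℝ
  ub : ℝ
  α_pos : 0 < α
  β_pos : 0 < β
  q_pos : 0 < q
  q_lt_one : q < 1
  ua_neg : ua < 0
  ub_pos : 0 < ub

namespace ControlProblem

/-- The Huber-like local smoothing `h_{q,γ}` of the absolute value. -/
def huber (q γ t : ℝ) : ℝ :=
  if |t| ≤ 1 / γ then q * γ ^ ((1 - q) / q) * |t| ^ (1 / q) else |t| - (1 - q) / γ

/-- `δ_γ = q^q γ^{1-q}`. -/
def delta (q γ : ℝ) : ℝ := q ^ q * γ ^ (1 - q)

/-- The function `j`, which is the derivative of `t ↦ δ_γ |t| - h_{q,γ}(t)^q`. -/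
def jfun (q γ t : ℝ) : ℝ :=
  if 1 / γ < |t| then (delta q γ - q * (|t| + (q - 1) / γ) ^ (q - 1)) * SignType.sign t else 0

variable (P : ControlProblem Ω)

theorem yd_memLp_two : MemLp P.yd 2 (volume.restrict Ω) :=
  haveI : IsFiniteMeasure (volume.restrict Ω) :=
    ⟨by rw [Measure.restrict_apply_univ]; exact P.domain.isBounded.measure_lt_top⟩
  P.yd_memLp.mono_exponent P.two_lt_p.le

/-- The desired state as an element of `L²(Ω)`. -/
def ydL2 : L2 Ω := P.yd_memLp_two.toLp P.yd

/-- The admissible controls `u_a ≤ u ≤ u_b` almost everywhere. -/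
def Uad : Set (L2 Ω) := {u | ∀ᵐ x ∂(volume.restrict Ω), P.ua ≤ u x ∧ u x ≤ P.ub}

/-- The penalty `Υ_{q,γ}(u) = ∫_Ω h_{q,γ}(u)^q`. -/
def penalty (γ : ℝ) (u : L2 Ω) : ℝ := ∫ x in Ω, huber P.q γ (u x) ^ P.q

/-- The cost of a pair of a state and a control. -/
def cost (γ : ℝ) (y : H01 Ω) (u : L2 Ω) : ℝ :=
  1 / 2 * ‖toL2 y - P.ydL2‖ ^ 2 + P.α / 2 * ‖u‖ ^ 2 + P.β * P.penalty γ u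

/-- The state `y = S (u + f)` associated with the control `u`. -/
def state (u : L2 Ω) : H01 Ω := solOp P.domain P.A (u + P.f)

/-- The reduced cost `J_γ(u)` of an admissible control. -/
def J (γ : ℝ) (u : L2 Ω) : ℝ := P.cost γ (P.state u) u

/-- The KKT system for a control `u` with state `y`, adjoint state `φ` and multipliers `ζ`, `lama`,
`lamb`. -/
structure KKTSystem (γ : ℝ) (u : L2 Ω) (y φ : H01 Ω) (ζ : Plane → ℝ) (lama lamb : L2 Ω) :
    Prop where
  state_eq : P.A.IsWeakSolution (u + P.f) y
  adjoint_eq : P.A.IsAdjointSolution (toL2 y - P.ydL2) φ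
  zeta_memLp : MemLp ζ ∞ (volume.restrict Ω)
  gradient_eq : ∀ᵐ x ∂(volume.restrict Ω),
    toL2 φ x + P.α * u x + P.β * (delta P.q γ * ζ x - jfun P.q γ (u x)) + lamb x - lama x = 0
  lama_nonneg : ∀ᵐ x ∂(volume.restrict Ω), 0 ≤ lama x
  lamb_nonneg : ∀ᵐ x ∂(volume.restrict Ω), 0 ≤ lamb x
  lama_compl : ∀ᵐ x ∂(volume.restrict Ω), lama x * (u x - P.ua) = 0
  lamb_compl : ∀ᵐ x ∂(volume.restrict Ω), lamb x * (P.ub - u x) = 0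
  zeta_pos : ∀ᵐ x ∂(volume.restrict Ω), 0 < u x → ζ x = 1
  zeta_neg : ∀ᵐ x ∂(volume.restrict Ω), u x < 0 → ζ x = -1
  zeta_zero : ∀ᵐ x ∂(volume.restrict Ω), u x = 0 → |ζ x| ≤ 1

/-- The control `u` satisfies the KKT system, for suitable state, adjoint state and multipliers. -/
def SatisfiesKKT (γ : ℝ) (u : L2 Ω) : Prop :=
  ∃ (y φ : H01 Ω) (ζ : Plane → ℝ) (lama lamb : L2 Ω), P.KKTSystem γ u y φ ζ lama lamb

/-- `s* = (β q (1 - q) / α)^{1 / (2 - q)}`. -/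
def sStar : ℝ := (P.β / P.α * P.q * (1 - P.q)) ^ (1 / (2 - P.q))

/-- The gap assumption: for some `C > 1`, `|u| ≥ C s* + (1 - q) / γ` almost everywhere where `u` does
not vanish. -/
def SupportGap (γ : ℝ) (u : L2 Ω) : Prop :=
  ∃ C : ℝ, 1 < C ∧ ∀ᵐ x ∂(volume.restrict Ω),
    u x ≠ 0 → C * P.sStar + (1 - P.q) / γ ≤ |u x|

end ControlProblem

end DCControl

end

/-! ### A quadratic tangent bound for concave powers -/

namespace DCControl

open Real

/-! The tracking term is exactly quadratic in `u` with nonnegative second-order part, so that part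
is dropped and everything becomes pointwise. What remains is a contest between the convexity of `α/2
t²` and the concavity of `β h^q`. Beyond the kink `|t| = 1/γ` the penalty is a shifted power, with
second derivative at least `-q(1-q)m^(q-2)` where the shifted argument is at least `m`; for `m =
s*`, `β` times this is exactly `-α`. The gap `C > 1` leaves room for some `m > s*`, so `α` wins
strictly on the support of `ū`, provided `u` is uniformly close to `ū`. Where `ū = 0` and `|u| ≤
1/γ`, the penalty is exactly `δ_γ|u|`, and `ζ` is a subgradient of the absolute value. Both cases
are merged in `huber_rpow_sub_ge`; the KKT equation then cancels the first-order terms up to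
multipliers of good sign, and `J_sub_ge_of_ae` integrates the result. -/

/-- On `[m, ∞)` the concave function `t ^ q` stays above its tangent lines up to a quadratic
error. -/
theorem rpow_sub_rpow_ge_of_ge {q m s t : ℝ} (hq0 : 0 < q) (hq1 : q < 1) (hm : 0 < m)
    (hs : m ≤ s) (ht : m ≤ t) :
    q * s ^ (q - 1) * (t - s) - q * (1 - q) * m ^ (q - 2) / 2 * (t - s) ^ 2 ≤ t ^ q - s ^ q := by
  -- `K` bounds the modulus of the second derivative on `[m, ∞)`, since `x ^ (q - 2)` decreases;
  -- adding `K / 2 * x ^ 2` restores convexity.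
  set K : ℝ := q * (1 - q) * m ^ (q - 2) with hK
  have hd : ∀ x : ℝ, m ≤ x →
      HasDerivAt (fun x ↦ x ^ q + K / 2 * x ^ 2) (q * x ^ (q - 1) + K * x) x := fun x hx ↦ by
    have h1 := hasDerivAt_rpow_const (x := x) (p := q) (.inl (hm.trans_le hx).ne')
    have h2 := (hasDerivAt_pow 2 x).const_mul (K / 2)
    refine (h1.add h2).congr_deriv ?_
    norm_num; ring
  have hd2 : ∀ x : ℝ, m ≤ x →
      HasDerivAt (fun x ↦ q * x ^ (q - 1) + K * x) (q * ((q - 1) * x ^ (q - 2)) + K) x :=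
    fun x hx ↦ by
      have h1 := (hasDerivAt_rpow_const (x := x) (p := q - 1)
        (.inl (hm.trans_le hx).ne')).const_mul q
      have h2 := (hasDerivAt_id x).const_mul K
      refine (h1.add h2).congr_deriv ?_
      rw [show q - 1 - 1 = q - 2 by ring]; ring
  have hconv : ConvexOn ℝ (Ici m) (fun x ↦ x ^ q + K / 2 * x ^ 2) := by
    refine convexOn_of_hasDerivWithinAt2_nonneg (convex_Ici m)
      (fun x hx ↦ (hd x hx).continuousAt.continuousWithinAt)
      (fun x hx ↦ (hd x (interior_subset hx)).hasDerivWithinAt)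
      (fun x hx ↦ (hd2 x (interior_subset hx)).hasDerivWithinAt) fun x hx ↦ ?_
    have hx' : m ≤ x := interior_subset (s := Ici m) hx
    have h3 : x ^ (q - 2) ≤ m ^ (q - 2) := rpow_le_rpow_of_nonpos hm hx' (by linarith)
    have h4 := mul_le_mul_of_nonneg_left h3 (mul_nonneg hq0.le (sub_nonneg.2 hq1.le))
    rw [hK]; linarith
  have htan : (q * s ^ (q - 1) + K * s) * (t - s) ≤
      (t ^ q + K / 2 * t ^ 2) - (s ^ q + K / 2 * s ^ 2) := by
    rcases lt_trichotomy s t with h | rfl | h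
    · have := hconv.le_slope_of_hasDerivAt hs ht h (hd s hs)
      rw [slope_def_field, le_div_iff₀ (sub_pos.2 h)] at this
      exact this
    · simp
    · have := hconv.slope_le_of_hasDerivAt ht hs h (hd s hs)
      rw [slope_def_field, div_le_iff₀ (sub_pos.2 h)] at this
      linarith
  linarith [show K * s * (t - s) = K / 2 * t ^ 2 - K / 2 * s ^ 2 - K / 2 * (t - s) ^ 2 by ring]

namespace ControlProblem

/-! ### Pointwise estimates for the penalty -/

theorem huber_neg (q γ t : ℝ) : huber q γ (-t) = huber q γ t := by
  simp [huber]

theorem jfun_neg (q γ t : ℝ) : jfun q γ (-t) = -jfun q γ t := by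
  simp only [jfun, abs_neg, Left.sign_neg]
  split_ifs <;> simp

theorem jfun_zero (q γ : ℝ) : jfun q γ 0 = 0 := by
  simp [jfun]

/-- The outer power `q` undoes the inner `1 / q`: near zero the penalty keeps a genuine kink, which
is why a subgradient `ζ` enters the KKT system. -/
theorem huber_rpow_of_abs_le {q γ t : ℝ} (hq : 0 < q) (hγ : 0 < γ) (ht : |t| ≤ 1 / γ) :
    huber q γ t ^ q = delta q γ * |t| := by
  rw [huber, if_pos ht, mul_rpow (by positivity) (by positivity),
    mul_rpow hq.le (by positivity), ← rpow_mul hγ.le, ← rpow_mul (abs_nonneg t),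
    div_mul_cancel₀ _ hq.ne', div_mul_cancel₀ _ hq.ne', rpow_one, delta]

theorem huber_of_lt {q γ t : ℝ} (hγ : 0 < γ) (ht : 1 / γ < t) :
    huber q γ t = t - (1 - q) / γ := by
  have h0 : 0 < t := (one_div_pos.2 hγ).trans ht
  rw [huber, abs_of_pos h0, if_neg ht.not_ge]

theorem jfun_of_lt {q γ t : ℝ} (hγ : 0 < γ) (ht : 1 / γ < t) :
    jfun q γ t = delta q γ - q * (t - (1 - q) / γ) ^ (q - 1) := by
  have h0 : 0 < t := (one_div_pos.2 hγ).trans ht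
  rw [jfun, abs_of_pos h0, if_pos ht, sign_pos h0]
  simp only [SignType.coe_one, mul_one]
  congr 3; ring

theorem continuous_huber {q γ : ℝ} (hq : 0 < q) (hγ : 0 < γ) : Continuous (huber q γ) := by
  refine Continuous.if_le ?_ ?_ continuous_abs continuous_const fun t ht ↦ ?_
  · exact continuous_const.mul (continuous_abs.rpow_const fun _ ↦ .inr (by positivity))
  · fun_prop
  -- At `|t| = 1 / γ` both branches equal `q / γ`.
  · rw [ht, one_div, inv_rpow hγ.le, ← rpow_neg hγ.le, mul_assoc, ← rpow_add hγ,
      show (1 - q) / q + -(1 / q) = -1 by field_simp; ring, rpow_neg_one]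
    field_simp; ring

theorem continuous_huber_rpow {q γ : ℝ} (hq : 0 < q) (hγ : 0 < γ) :
    Continuous fun t ↦ huber q γ t ^ q :=
  (continuous_huber hq hγ).rpow_const fun _ ↦ .inr hq.le

/-- Lower bound for the penalty increment at a positive control value away from the kink. -/
theorem huber_rpow_sub_ge_of_pos {q γ m s t : ℝ} (hq0 : 0 < q) (hq1 : q < 1) (hγ : 0 < γ)
    (hm : q / γ < m) (hs : m + (1 - q) / γ ≤ s) (ht : m + (1 - q) / γ ≤ t) :
    (delta q γ - jfun q γ s) * (t - s) - q * (1 - q) * m ^ (q - 2) / 2 * (t - s) ^ 2 ≤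
      huber q γ t ^ q - huber q γ s ^ q := by
  -- The condition `q / γ < m` says precisely that the shifted threshold lies beyond the kink.
  have h1 : 1 / γ < m + (1 - q) / γ := by
    have : (1 - q) / γ = 1 / γ - q / γ := sub_div _ _ _
    linarith
  rw [huber_of_lt hγ (h1.trans_le ht), huber_of_lt hγ (h1.trans_le hs),
    jfun_of_lt hγ (h1.trans_le hs)]
  have := rpow_sub_rpow_ge_of_ge (s := s - (1 - q) / γ) (t := t - (1 - q) / γ) hq0 hq1
    ((div_pos hq0 hγ).trans hm) (by linarith) (by linarith)
  rw [sub_sub_sub_cancel_right] at this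
  linarith

/-- Lower bound for the penalty increment by its generalized derivative, at a control value that is
zero or away from the kink. -/
theorem huber_rpow_sub_ge {q γ m r s t ζ : ℝ} (hq0 : 0 < q) (hq1 : q < 1) (hγ : 0 < γ)
    (hm : q / γ < m) (hr : |t - s| ≤ r) (hrγ : r ≤ 1 / γ)
    (hgap : s ≠ 0 → m + r + (1 - q) / γ ≤ |s|)
    (hpos : 0 < s → ζ = 1) (hneg : s < 0 → ζ = -1) (hzero : s = 0 → |ζ| ≤ 1) :
    (delta q γ * ζ - jfun q γ s) * (t - s) - q * (1 - q) * m ^ (q - 2) / 2 * (t - s) ^ 2 ≤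
      huber q γ t ^ q - huber q γ s ^ q := by
  have hr0 : 0 ≤ r := (abs_nonneg _).trans hr
  have hm0 : 0 < m := (div_pos hq0 hγ).trans hm
  obtain ⟨hl, hu⟩ := abs_le.1 hr
  rcases lt_trichotomy s 0 with h | rfl | h
  · have hg := hgap h.ne
    rw [abs_of_neg h] at hg
    have := huber_rpow_sub_ge_of_pos (s := -s) (t := -t) hq0 hq1 hγ hm (by linarith) (by linarith)
    rw [huber_neg, huber_neg, jfun_neg] at this
    rw [hneg h]
    refine le_trans (le_of_eq ?_) this
    ring
  -- At a zero of the control the subgradient inequality suffices; the quadratic term is pure slack.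
  · have hδ : 0 ≤ delta q γ := by unfold delta; positivity
    have hq1' : 0 ≤ 1 - q := by linarith
    rw [sub_zero] at hr ⊢
    rw [jfun_zero, huber_rpow_of_abs_le hq0 hγ (hr.trans hrγ),
      huber_rpow_of_abs_le hq0 hγ (by simpa using hγ.le)]
    have h1 : ζ * t ≤ |t| := by
      refine (le_abs_self _).trans ?_
      rw [abs_mul]
      exact mul_le_of_le_one_left (abs_nonneg t) (hzero rfl)
    have h2 := mul_le_mul_of_nonneg_left h1 hδ
    have h3 : 0 ≤ q * (1 - q) * m ^ (q - 2) / 2 * t ^ 2 := by positivity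
    simp only [abs_zero, mul_zero, sub_zero]
    linarith
  · have hg := hgap h.ne'
    rw [abs_of_pos h] at hg
    rw [hpos h, mul_one]
    exact huber_rpow_sub_ge_of_pos hq0 hq1 hγ hm (by linarith) (by linarith)

/-! ### Reduction of the cost increment to a pointwise inequality -/

variable {Ω : Set Plane} (P : ControlProblem Ω)

theorem sStar_pos : 0 < P.sStar := by
  have := P.α_pos
  have := P.β_pos
  have := P.q_pos
  have : 0 < 1 - P.q := sub_pos.2 P.q_lt_one
  unfold sStar; positivity

/-- This characterises `s*` as the balance point between the penalty's concavity and the Tikhonov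
term. -/
theorem sStar_rpow : P.β * (P.q * (1 - P.q) * P.sStar ^ (P.q - 2)) = P.α := by
  have h1 := P.α_pos
  have h2 := P.β_pos
  have h3 := P.q_pos
  have h4 : 0 < 1 - P.q := sub_pos.2 P.q_lt_one
  have h5 : 2 - P.q ≠ 0 := by linarith
  rw [sStar, ← rpow_mul (by positivity), show 1 / (2 - P.q) * (P.q - 2) = -1 by field_simp; ring,
    rpow_neg_one]
  field_simp

theorem isFiniteMeasure_restrict (P : ControlProblem Ω) :
    IsFiniteMeasure (volume.restrict Ω) :=
  ⟨by rw [Measure.restrict_apply_univ]; exact P.domain.isBounded.measure_lt_top⟩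

theorem integrable_penalty {γ : ℝ} (hγ : 0 < γ) {u : L2 Ω} (hu : u ∈ P.Uad) :
    Integrable (fun x ↦ huber P.q γ (u x) ^ P.q) (volume.restrict Ω) := by
  have := P.isFiniteMeasure_restrict
  have hc := continuous_huber_rpow P.q_pos hγ
  obtain ⟨M, hM⟩ := (isCompact_Icc (a := P.ua) (b := P.ub)).exists_bound_of_continuousOn
    hc.continuousOn
  refine .of_bound (hc.comp_aestronglyMeasurable (Lp.aestronglyMeasurable u)) M ?_
  filter_upwards [hu] with x hx
  exact hM _ hx

/-- Replacing the adjoint equation by the derivative of the tracking term. -/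
theorem inner_tracking_eq {w : L2 Ω} {φ : H01 Ω} (hφ : P.A.IsAdjointSolution w φ) (v : L2 Ω) :
    inner ℝ w (toL2 (solOp P.domain P.A v)) = inner ℝ v (toL2 φ) := by
  -- Testing each equation with the solution of the other gives the same value of the form.
  rw [← hφ, (isWeakSolution_iff P.domain P.A v _).2 rfl φ]

theorem toL2_state_sub (u w : L2 Ω) :
    toL2 (P.state u) = toL2 (P.state w) + toL2 (solOp P.domain P.A (u - w)) := by
  simp only [← toL2L_apply, state, ← map_add]
  congr 2; abel

/-- The increment of the reduced cost is at least that of its first-order part in the tracking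
term. -/
theorem J_sub_ge {γ : ℝ} {w : L2 Ω} {φ : H01 Ω}
    (hφ : P.A.IsAdjointSolution (toL2 (P.state w) - P.ydL2) φ) (u : L2 Ω) :
    inner ℝ (u - w) (toL2 φ) + P.α * inner ℝ (u - w) w + P.α / 2 * ‖u - w‖ ^ 2 +
      P.β * (P.penalty γ u - P.penalty γ w) ≤ P.J γ u - P.J γ w := by
  have h1 : ‖toL2 (P.state u) - P.ydL2‖ ^ 2 = ‖toL2 (P.state w) - P.ydL2‖ ^ 2 +
      2 * inner ℝ (u - w) (toL2 φ) + ‖toL2 (solOp P.domain P.A (u - w))‖ ^ 2 := by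
    rw [P.toL2_state_sub u w, add_sub_right_comm, norm_add_sq_real, P.inner_tracking_eq hφ]
  have h2 : ‖u‖ ^ 2 = ‖w‖ ^ 2 + 2 * inner ℝ (u - w) w + ‖u - w‖ ^ 2 := by
    conv_lhs => rw [← add_sub_cancel w u, norm_add_sq_real, real_inner_comm]
  have h3 := sq_nonneg ‖toL2 (solOp P.domain P.A (u - w))‖
  simp only [J, cost]
  rw [h1, h2]
  linarith

/-- A pointwise growth condition on the first-order part of the cost integrates to quadratic growth
of the reduced cost. -/
theorem J_sub_ge_of_ae {γ σ : ℝ} (hγ : 0 < γ) {u w : L2 Ω} (hu : u ∈ P.Uad) (hw : w ∈ P.Uad)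
    {φ : H01 Ω} (hφ : P.A.IsAdjointSolution (toL2 (P.state w) - P.ydL2) φ)
    (h : ∀ᵐ x ∂(volume.restrict Ω), σ * (u x - w x) ^ 2 ≤
      (u x - w x) * (toL2 φ x + P.α * w x) + P.α / 2 * (u x - w x) ^ 2 +
        P.β * (huber P.q γ (u x) ^ P.q - huber P.q γ (w x) ^ P.q)) :
    σ * ‖u - w‖ ^ 2 ≤ P.J γ u - P.J γ w := by
  refine le_trans ?_ (P.J_sub_ge hφ u)
  have e1 : inner ℝ (u - w) (toL2 φ) + P.α * inner ℝ (u - w) w + P.α / 2 * ‖u - w‖ ^ 2 =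
      inner ℝ (u - w) (toL2 φ + P.α • w + (P.α / 2) • (u - w)) := by
    rw [inner_add_right, inner_add_right, inner_smul_right, inner_smul_right,
      real_inner_self_eq_norm_sq]
  have e2 : σ * ‖u - w‖ ^ 2 = inner ℝ (u - w) (σ • (u - w)) := by
    rw [inner_smul_right, real_inner_self_eq_norm_sq]
  have hpen : Integrable (fun x ↦ P.β * (huber P.q γ (u x) ^ P.q - huber P.q γ (w x) ^ P.q))
      (volume.restrict Ω) :=
    ((P.integrable_penalty hγ hu).sub (P.integrable_penalty hγ hw)).const_mul _
  rw [e1, e2, penalty, penalty,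
    ← integral_sub (P.integrable_penalty hγ hu) (P.integrable_penalty hγ hw),
    ← integral_const_mul, L2.inner_def, L2.inner_def, ← integral_add (L2.integrable_inner _ _) hpen]
  refine integral_mono_ae (L2.integrable_inner _ _) ((L2.integrable_inner _ _).add hpen) ?_
  filter_upwards [h, Lp.coeFn_sub u w, Lp.coeFn_smul σ (u - w), Lp.coeFn_smul P.α w,
    Lp.coeFn_smul (P.α / 2) (u - w), Lp.coeFn_add (toL2 φ) (P.α • w),
    Lp.coeFn_add (toL2 φ + P.α • w) ((P.α / 2) • (u - w))] with x h h1 h2 h3 h4 h5 h6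
  simp only [h1, h2, h3, h4, h5, h6, Pi.add_apply, Pi.sub_apply, Pi.smul_apply, smul_eq_mul,
    RCLike.inner_apply, conj_trivial]
  linarith

/-- The multipliers of the control constraints act with a favourable sign on feasible
directions. -/
theorem multiplier_nonneg {ua ub u w la lb : ℝ} (hu : ua ≤ u ∧ u ≤ ub) (hla : 0 ≤ la)
    (hlb : 0 ≤ lb) (hca : la * (w - ua) = 0) (hcb : lb * (ub - w) = 0) :
    0 ≤ (la - lb) * (u - w) := by
  have h1 := mul_nonneg hla (sub_nonneg.2 hu.1)
  have h2 := mul_nonneg hlb (sub_nonneg.2 hu.2)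
  linarith

end ControlProblem

end DCControl

/-! ### Quadratic growth -/

theorem theoremt {Ω : Set DCControl.Plane} (P : DCControl.ControlProblem Ω) :
    ∃ γ₀ : ℝ, 0 < γ₀ ∧ ∀ γ : ℝ, γ₀ < γ →
      ∀ ubar ∈ P.Uad, P.SatisfiesKKT γ ubar → P.SupportGap γ ubar →
        ∃ ϱ : ℝ, 0 < ϱ ∧ ∃ σ : ℝ, 0 < σ ∧
          ∀ u ∈ P.Uad, eLpNorm (u - ubar) ∞ (volume.restrict Ω) ≤ ENNReal.ofReal ϱ →
            σ * ‖u - ubar‖ ^ 2 ≤ P.J γ u - P.J γ ubar := by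
  have hs := P.sStar_pos
  have hq0 := P.q_pos
  have hq1 := P.q_lt_one
  have hα := P.α_pos
  -- This threshold gives `q / γ < s* < m`, placing the support of `ū` beyond the kink.
  refine ⟨P.q / P.sStar, div_pos hq0 hs, fun γ hγ ubar hbar hKKT hgap ↦ ?_⟩
  obtain ⟨y, φ, ζ, lama, lamb, K⟩ := hKKT
  obtain ⟨C, hC, hgap⟩ := hgap
  have hγ0 : 0 < γ := (div_pos hq0 hs).trans hγ
  have hγs : P.q / γ < P.sStar := by
    rw [div_lt_iff₀ hs] at hγ
    rw [div_lt_iff₀ hγ0]; linarith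
  have hC' : 1 < (1 + C) / 2 := by linarith
  -- The midpoint of `s*` and `C s*`: one half of the gap yields strict curvature, the other half is
  -- room for `u` to move.
  set m : ℝ := (1 + C) / 2 * P.sStar with hm
  have hsm : P.sStar < m := lt_mul_of_one_lt_left hs hC'
  have hC0 : 0 < (C - 1) / 2 * P.sStar := mul_pos (by linarith) hs
  have hpow : P.β * (P.q * (1 - P.q) * m ^ (P.q - 2)) =
      P.α * ((1 + C) / 2) ^ (P.q - 2) := by
    rw [hm, Real.mul_rpow (by linarith) hs.le, ← P.sStar_rpow]; ring
  have hlt : ((1 + C) / 2) ^ (P.q - 2) < 1 := Real.rpow_lt_one_of_one_lt_of_neg hC' (by linarith)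
  -- The first bound keeps `u` beyond `m + (1 - q) / γ` on the support, with unchanged sign; the
  -- second keeps it in the linear zone where `ū = 0`. The growth constant is half the curvature
  -- surplus.
  refine ⟨min ((C - 1) / 2 * P.sStar) (1 / γ), lt_min hC0 (one_div_pos.2 hγ0),
    P.α / 2 * (1 - ((1 + C) / 2) ^ (P.q - 2)), mul_pos (by linarith) (by linarith),
    fun u hu hdist ↦ ?_⟩
  have hy : y = P.state ubar := (DCControl.isWeakSolution_iff P.domain P.A _ _).1 K.state_eq
  refine P.J_sub_ge_of_ae hγ0 hu hbar (hy ▸ K.adjoint_eq) ?_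
  have hclose : ∀ᵐ x ∂(volume.restrict Ω),
      |u x - ubar x| ≤ min ((C - 1) / 2 * P.sStar) (1 / γ) := by
    rw [eLpNorm_exponent_top] at hdist
    filter_upwards [ae_le_eLpNormEssSup (f := ⇑(u - ubar)) (μ := volume.restrict Ω),
      Lp.coeFn_sub u ubar] with x h1 h2
    have h3 := h1.trans hdist
    rw [h2, Real.enorm_eq_ofReal_abs,
      ENNReal.ofReal_le_ofReal_iff (lt_min hC0 (one_div_pos.2 hγ0)).le] at h3
    exact h3
  filter_upwards [hclose, hu, hgap, K.gradient_eq, K.lama_nonneg, K.lamb_nonneg, K.lama_compl,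
    K.lamb_compl, K.zeta_pos, K.zeta_neg, K.zeta_zero]
    with x hx hux hgx hgrad hla hlb hca hcb hpos hneg hzero
  have hr := min_le_left ((C - 1) / 2 * P.sStar) (1 / γ)
  have hpen := DCControl.ControlProblem.huber_rpow_sub_ge hq0 hq1 hγ0 (hγs.trans hsm) hx
    (min_le_right _ _) (fun h ↦ by linarith [hgx h]) hpos hneg hzero
  have hmul := DCControl.ControlProblem.multiplier_nonneg hux hla hlb hca hcb
  have hpen' := mul_le_mul_of_nonneg_left hpen P.β_pos.le
  -- Multiplied by `u - ū`, the KKT equation turns the first-order terms into `(λ_a - λ_b)(u - ū)`,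
  -- nonnegative by `hmul`.
  have hgrad' := congrArg (· * (u x - ubar x)) hgrad
  have hpow' := congrArg (· * ((u x - ubar x) ^ 2 / 2)) hpow
  linarith
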